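/- Let $\mathbf Z$ be a Dedekind domain, that is, a Noetherian Prüfer domain (for instance an explicit one, i.e. one with a divisibility test); here an integral domain is a Prüfer domain if for every finite family $a_0,\dots,a_n$ in it there are $s_0,\dots,s_n$ in it with $\sum_i s_i=1$ and $s_i\langle a_0,\dots,a_n\rangle\subseteq\langle a_i\rangle$ for all $i$. Let $\mathbf K$ be the field of fractions of $\mathbf Z$. A pseudo-matrix of size $n\times m$ over $\mathbf Z$ is a datum $A=(\mathfrak h_1,\dots,\mathfrak h_n;\mathfrak e_1,\dots,\mathfrak e_m;\underline A)$, where the $\mathfrak h_i$ and $\mathfrak e_j$ are invertible fractional ideals of $\mathbf Z$ and $\underline A=(a_{ij})$ is an $n\times m$ matrix over $\mathbf K$ with $a_{ij}\mathfrak e_j\subseteq\mathfrak h_i$ for all $i,j$. The product of $(\underline{\mathfrak c};\underline{\mathfrak h};\underline B)$ and $(\underline{\mathfrak h};\underline{\mathfrak e};\underline A)$ is $(\underline{\mathfrak c};\underline{\mathfrak e};\underline B\,\underline A)$. A square pseudo-matrix $(\underline{\mathfrak h};\underline{\mathfrak e};\underline A)$ is invertible if there is a pseudo-matrix $(\underline{\mathfrak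 e};\underline{\mathfrak h};\underline B)$ with $\underline A\,\underline B=\underline B\,\underline A=I$. Two pseudo-matrices $A=(\underline{\mathfrak h};\underline{\mathfrak e};\underline A)$ and $A'=(\underline{\mathfrak h}';\underline{\mathfrak e}';\underline A')$ of the same size are equivalent if $A'=L\,A\,C$ for some invertible pseudo-matrices $L=(\underline{\mathfrak h}';\underline{\mathfrak h};\underline L)$ and $C=(\underline{\mathfrak e};\underline{\mathfrak e}';\underline C)$. An $n\times m$ pseudo-matrix $A$ is in Smith form if $a_{ij}=0$ whenever $i\ne j$ and, with $p=\min(n,m)$, the diagonal minor ideals of order one $\mathfrak c_i:=a_{ii}\,\mathfrak e_i\,\mathfrak h_i^{-1}$ satisfy $\mathfrak c_1\supseteq\mathfrak c_2\supseteq\cdots\supseteq\mathfrak c_p$. Then every pseudo-matrix over $\mathbf Z$ is equivalent to a pseudo-matrix in Smith form. -/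

import Mathlib

open scoped nonZeroDivisors

/-- A Prüfer domain is an integral domain which is arithmetical: every finitely generated ideal
`⟨a₀, …, aₙ⟩` is locally principal, i.e. there are `s₀, …, sₙ` with sum `1` such that
`sᵢ ⟨a₀, …, aₙ⟩ ⊆ ⟨aᵢ⟩` for each `i`. -/
structure IsPruferDomain (Z : Type*) [CommRing Z] : Prop where
  isDomain : IsDomain Z
  locallyPrincipal : ∀ (n : ℕ) (a : Fin (n + 1) → Z), ∃ s : Fin (n + 1) → Z,
    ∑ i, s i = 1 ∧
      ∀ i, ∀ x ∈ Ideal.span (Set.range a), s i * x ∈ Ideal.span {a i}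

/-- Pseudo-matrices `(h₁, …, hₙ; e₁, …, eₘ; A)` over a domain `Z` with field of fractions `K`.
The `hᵢ` (row indices) and `eⱼ` (column indices) are invertible fractional ideals of `Z`, and `A`
is an `n × m` matrix over `K` such that `aᵢⱼ eⱼ ⊆ hᵢ` for all `i, j`. -/
@[ext]
structure PseudoMatrix {Z : Type*} [CommRing Z] {K : Type*} [Field K] [Algebra Z K]
    {n m : ℕ} (h : Fin n → (FractionalIdeal Z⁰ K)ˣ) (e : Fin m → (FractionalIdeal Z⁰ K)ˣ) where
  mat : Matrix (Fin n) (Fin m) K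
  mul_mem : ∀ i j, ∀ x ∈ (e j : FractionalIdeal Z⁰ K),
    mat i j * x ∈ (h i : FractionalIdeal Z⁰ K)

namespace PseudoMatrix

variable {Z : Type*} [CommRing Z] {K : Type*} [Field K] [Algebra Z K]

/-- The product `(c; h; B) · (h; e; A) = (c; e; B A)`. -/
def mul {l n m : ℕ} {c : Fin l → (FractionalIdeal Z⁰ K)ˣ} {h : Fin n → (FractionalIdeal Z⁰ K)ˣ}
    {e : Fin m → (FractionalIdeal Z⁰ K)ˣ} (B : PseudoMatrix c h) (A : PseudoMatrix h e) :
    PseudoMatrix c e where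
  mat := B.mat * A.mat
  mul_mem i j x hx := by
    rw [Matrix.mul_apply, Finset.sum_mul, ← FractionalIdeal.mem_coe]
    refine Submodule.sum_mem _ fun k _ => ?_
    rw [mul_assoc]
    exact B.mul_mem i k _ (A.mul_mem k j x hx)

/-- The identity pseudo-matrix `(e; e; I)`. -/
def one {n : ℕ} (e : Fin n → (FractionalIdeal Z⁰ K)ˣ) : PseudoMatrix e e where
  mat := 1
  mul_mem i j x hx := by
    by_cases hij : i = j
    · subst hij
      simpa using hx
    · rw [Matrix.one_apply_ne hij, zero_mul]
      exact FractionalIdeal.zero_mem _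

/-- A square pseudo-matrix `(h; e; A)` is invertible if it has a two-sided inverse which is a
pseudo-matrix `(e; h; B)`. -/
def IsInvertible {n : ℕ} {h e : Fin n → (FractionalIdeal Z⁰ K)ˣ} (A : PseudoMatrix h e) : Prop :=
  ∃ B : PseudoMatrix e h, A.mul B = one h ∧ B.mul A = one e

/-- Two pseudo-matrices `A = (h; e; A)` and `A' = (h'; e'; A')` of the same size are equivalent if
`A' = L A C` for some invertible pseudo-matrices `L` and `C`, the changes of pseudo-bases of the
target and of the source. -/
def Equivalent {n m : ℕ} {h h' : Fin n → (FractionalIdeal Z⁰ K)ˣ}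
    {e e' : Fin m → (FractionalIdeal Z⁰ K)ˣ} (A : PseudoMatrix h e) (A' : PseudoMatrix h' e') :
    Prop :=
  ∃ (L : PseudoMatrix h' h) (C : PseudoMatrix e e'),
    L.IsInvertible ∧ C.IsInvertible ∧ (L.mul A).mul C = A'

/-- The minor ideal of order one `aᵢⱼ eⱼ hᵢ⁻¹`. -/
noncomputable def minorIdeal [IsFractionRing Z K] {n m : ℕ}
    {h : Fin n → (FractionalIdeal Z⁰ K)ˣ} {e : Fin m → (FractionalIdeal Z⁰ K)ˣ}
    (A : PseudoMatrix h e) (i : Fin n) (j : Fin m) : FractionalIdeal Z⁰ K :=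
  FractionalIdeal.spanSingleton Z⁰ (A.mat i j) * (e j : FractionalIdeal Z⁰ K) *
    (((h i)⁻¹ : (FractionalIdeal Z⁰ K)ˣ) : FractionalIdeal Z⁰ K)

/-- A pseudo-matrix is in Smith form if all its entries off the diagonal vanish and, with
`p = min n m`, its diagonal minor ideals of order one `cᵢ` satisfy `c₁ ⊇ c₂ ⊇ ⋯ ⊇ cₚ`. -/
def IsSmith [IsFractionRing Z K] {n m : ℕ}
    {h : Fin n → (FractionalIdeal Z⁰ K)ˣ} {e : Fin m → (FractionalIdeal Z⁰ K)ˣ}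
    (A : PseudoMatrix h e) : Prop :=
  (∀ (i : Fin n) (j : Fin m), (i : ℕ) ≠ (j : ℕ) → A.mat i j = 0) ∧
    Antitone fun k : Fin (min n m) =>
      A.minorIdeal (Fin.castLE (min_le_left n m) k) (Fin.castLE (min_le_right n m) k)

end PseudoMatrix

namespace PseudoMatrix
open FractionalIdeal

section Minors

variable {Z : Type*} [CommRing Z] {K : Type*} [Field K] [Algebra Z K]
variable {ι κ τ : Type*}

lemma mul_inv_le_iff_le_mul {I J : FractionalIdeal Z⁰ K} (u : (FractionalIdeal Z⁰ K)ˣ) :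
    I * ((u⁻¹ : (FractionalIdeal Z⁰ K)ˣ) : FractionalIdeal Z⁰ K) ≤ J ↔
      I ≤ J * (u : FractionalIdeal Z⁰ K) := by
  constructor
  · intro H
    have := mul_le_mul_left H (u : FractionalIdeal Z⁰ K)
    simpa [mul_assoc] using this
  · intro H
    have := mul_le_mul_left H ((u⁻¹ : (FractionalIdeal Z⁰ K)ˣ) : FractionalIdeal Z⁰ K)
    simpa [mul_assoc] using this

variable [IsFractionRing Z K]

/-- All minor ideals of order one `mᵢⱼ eⱼ hᵢ⁻¹` are contained in `c`. For `c = 1` this says that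
`(h; e; M)` is a pseudo-matrix. -/
def MinorsLE (c : FractionalIdeal Z⁰ K) (h : ι → (FractionalIdeal Z⁰ K)ˣ)
    (e : κ → (FractionalIdeal Z⁰ K)ˣ) (M : Matrix ι κ K) : Prop :=
  ∀ i j, spanSingleton Z⁰ (M i j) * (e j : FractionalIdeal Z⁰ K) ≤ c * (h i : FractionalIdeal Z⁰ K)

lemma spanSingleton_add_le {x y : K} {I J : FractionalIdeal Z⁰ K}
    (hx : spanSingleton Z⁰ x * I ≤ J) (hy : spanSingleton Z⁰ y * I ≤ J) :
    spanSingleton Z⁰ (x + y) * I ≤ J := by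
  rw [spanSingleton_mul_le_iff] at *
  intro z hz
  rw [add_mul]
  exact Submodule.add_mem (J : Submodule Z K) (hx z hz) (hy z hz)

lemma spanSingleton_neg_le {x : K} {I J : FractionalIdeal Z⁰ K}
    (hx : spanSingleton Z⁰ x * I ≤ J) : spanSingleton Z⁰ (-x) * I ≤ J := by
  rw [spanSingleton_mul_le_iff] at *
  intro z hz
  rw [neg_mul]
  exact Submodule.neg_mem (J : Submodule Z K) (hx z hz)

lemma spanSingleton_sum_le {x : ι → K} {t : Finset ι} {I J : FractionalIdeal Z⁰ K}
    (hx : ∀ i ∈ t, spanSingleton Z⁰ (x i) * I ≤ J) :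
    spanSingleton Z⁰ (∑ i ∈ t, x i) * I ≤ J := by
  simp only [spanSingleton_mul_le_iff] at *
  intro z hz
  rw [Finset.sum_mul]
  exact Submodule.sum_mem (J : Submodule Z K) fun i hi => hx i hi z hz

lemma spanSingleton_mul_mul_le {x y : K} {I J L : FractionalIdeal Z⁰ K}
    (hy : spanSingleton Z⁰ y * I ≤ J) (hx : spanSingleton Z⁰ x * J ≤ L) :
    spanSingleton Z⁰ (x * y) * I ≤ L := by
  rw [spanSingleton_mul_le_iff] at *
  intro z hz
  rw [mul_assoc]
  exact hx _ (hy z hz)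

lemma spanSingleton_zero_mul_le (I J : FractionalIdeal Z⁰ K) :
    spanSingleton Z⁰ (0 : K) * I ≤ J := by
  simp

variable {c d : FractionalIdeal Z⁰ K} {h : ι → (FractionalIdeal Z⁰ K)ˣ}
  {e : κ → (FractionalIdeal Z⁰ K)ˣ} {f : τ → (FractionalIdeal Z⁰ K)ˣ}

lemma minorsLE_iff_mem {M : Matrix ι κ K} : MinorsLE 1 h e M ↔
    ∀ i j, ∀ x ∈ (e j : FractionalIdeal Z⁰ K), M i j * x ∈ (h i : FractionalIdeal Z⁰ K) := by
  simp only [MinorsLE, spanSingleton_mul_le_iff, one_mul]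

lemma MinorsLE.mul [Fintype κ] {M : Matrix ι κ K} {N : Matrix κ τ K} (hM : MinorsLE c h e M)
    (hN : MinorsLE d e f N) : MinorsLE (c * d) h f (M * N) := by
  intro i k
  rw [Matrix.mul_apply]
  refine spanSingleton_sum_le fun j _ => ?_
  rw [← spanSingleton_mul_spanSingleton, mul_assoc]
  calc _ ≤ spanSingleton Z⁰ (M i j) * (d * e j) := mul_le_mul_right (hN j k) _
    _ = d * (spanSingleton Z⁰ (M i j) * e j) := by ring
    _ ≤ d * (c * h i) := mul_le_mul_right (hM i j) _
    _ = _ := by ring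

lemma MinorsLE.add {M N : Matrix ι κ K} (hM : MinorsLE c h e M) (hN : MinorsLE c h e N) :
    MinorsLE c h e (M + N) := fun i j => spanSingleton_add_le (hM i j) (hN i j)

lemma MinorsLE.neg {M : Matrix ι κ K} (hM : MinorsLE c h e M) :
    MinorsLE c h e (-M) := fun i j => spanSingleton_neg_le (hM i j)

lemma MinorsLE.one [DecidableEq ι] : MinorsLE 1 h h (1 : Matrix ι ι K) := by
  intro i j
  by_cases hij : i = j
  · subst hij; simp
  · simp [Matrix.one_apply_ne hij]

lemma MinorsLE.transpose {M : Matrix ι κ K} (hM : MinorsLE c h e M) :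
    MinorsLE c e⁻¹ h⁻¹ M.transpose := by
  intro j i
  have := hM i j
  rw [Matrix.transpose_apply, Pi.inv_apply, Pi.inv_apply, mul_inv_le_iff_le_mul, mul_right_comm,
    ← inv_inv (e j), ← mul_inv_le_iff_le_mul, inv_inv]
  simpa using this

/-- The minor ideal of order one of `(h; e; M)` at `(i, j)`. -/
noncomputable def minorAt (h : ι → (FractionalIdeal Z⁰ K)ˣ) (e : κ → (FractionalIdeal Z⁰ K)ˣ)
    (M : Matrix ι κ K) (i : ι) (j : κ) : FractionalIdeal Z⁰ K :=
  spanSingleton Z⁰ (M i j) * (e j : FractionalIdeal Z⁰ K) *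
    (((h i)⁻¹ : (FractionalIdeal Z⁰ K)ˣ) : FractionalIdeal Z⁰ K)

lemma minorAt_transpose (M : Matrix ι κ K) (i : ι) (j : κ) :
    minorAt e⁻¹ h⁻¹ M.transpose j i = minorAt h e M i j := by
  simp [minorAt, mul_assoc, mul_comm]

lemma minorAt_le_iff {M : Matrix ι κ K} {i : ι} {j : κ} :
    minorAt h e M i j ≤ c ↔
      spanSingleton Z⁰ (M i j) * (e j : FractionalIdeal Z⁰ K) ≤ c * h i :=
  mul_inv_le_iff_le_mul _

lemma MinorsLE.minorAt_le {M : Matrix ι κ K} (hM : MinorsLE c h e M) (i : ι) (j : κ) :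
    minorAt h e M i j ≤ c := minorAt_le_iff.2 (hM i j)

/-- Equivalence of the pseudo-matrices `(h; e; A)` and `(h'; e'; A')`. -/
def EquivalentMat [Fintype ι] [DecidableEq ι] [Fintype κ] [DecidableEq κ]
    (h : ι → (FractionalIdeal Z⁰ K)ˣ) (e : κ → (FractionalIdeal Z⁰ K)ˣ) (A : Matrix ι κ K)
    (h' : ι → (FractionalIdeal Z⁰ K)ˣ) (e' : κ → (FractionalIdeal Z⁰ K)ˣ) (A' : Matrix ι κ K) :
    Prop :=
  ∃ L L' : Matrix ι ι K, ∃ C C' : Matrix κ κ K,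
    (MinorsLE 1 h' h L ∧ MinorsLE 1 h h' L' ∧ L * L' = 1 ∧ L' * L = 1) ∧
    (MinorsLE 1 e e' C ∧ MinorsLE 1 e' e C' ∧ C * C' = 1 ∧ C' * C = 1) ∧ A' = L * A * C

variable [Fintype ι] [DecidableEq ι] [Fintype κ] [DecidableEq κ]
  {h' h'' : ι → (FractionalIdeal Z⁰ K)ˣ} {e' e'' : κ → (FractionalIdeal Z⁰ K)ˣ}
  {A A' A'' : Matrix ι κ K}

lemma EquivalentMat.refl (h : ι → (FractionalIdeal Z⁰ K)ˣ) (e : κ → (FractionalIdeal Z⁰ K)ˣ)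
    (A : Matrix ι κ K) : EquivalentMat h e A h e A :=
  ⟨1, 1, 1, 1, ⟨.one, .one, one_mul _, one_mul _⟩, ⟨.one, .one, one_mul _, one_mul _⟩, by simp⟩

lemma mul_mul_mul_eq_one {n : Type*} [Fintype n] [DecidableEq n] {P P' Q Q' : Matrix n n K}
    (hP : P * P' = 1) (hQ : Q * Q' = 1) : (P * Q) * (Q' * P') = 1 := by
  rw [Matrix.mul_assoc, ← Matrix.mul_assoc Q, hQ, Matrix.one_mul, hP]

lemma EquivalentMat.trans (H : EquivalentMat h e A h' e' A')
    (H' : EquivalentMat h' e' A' h'' e'' A'') : EquivalentMat h e A h'' e'' A'' := by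
  obtain ⟨L, L', C, C', ⟨l1, l2, l3, l4⟩, ⟨c1, c2, c3, c4⟩, rfl⟩ := H
  obtain ⟨M, M', D, D', ⟨m1, m2, m3, m4⟩, ⟨d1, d2, d3, d4⟩, rfl⟩ := H'
  refine ⟨M * L, L' * M', C * D, D' * C', ⟨?_, ?_, mul_mul_mul_eq_one m3 l3,
    mul_mul_mul_eq_one l4 m4⟩, ⟨?_, ?_, mul_mul_mul_eq_one c3 d3, mul_mul_mul_eq_one d4 c4⟩,
    by simp only [Matrix.mul_assoc]⟩
  · simpa using m1.mul l1
  · simpa using l2.mul m2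
  · simpa using c1.mul d1
  · simpa using d2.mul c2

lemma EquivalentMat.transpose (H : EquivalentMat h e A h' e' A') :
    EquivalentMat e⁻¹ h⁻¹ A.transpose e'⁻¹ h'⁻¹ A'.transpose := by
  obtain ⟨L, L', C, C', ⟨l1, l2, l3, l4⟩, ⟨c1, c2, c3, c4⟩, rfl⟩ := H
  refine ⟨C.transpose, C'.transpose, L.transpose, L'.transpose,
    ⟨c1.transpose, c2.transpose, ?_, ?_⟩, ⟨l1.transpose, l2.transpose, ?_, ?_⟩, ?_⟩
  all_goals simp [← Matrix.transpose_mul, Matrix.mul_assoc, *]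

lemma EquivalentMat.of_transpose {B : Matrix κ ι K}
    (H : EquivalentMat e⁻¹ h⁻¹ A.transpose e'⁻¹ h'⁻¹ B) :
    EquivalentMat h e A h' e' B.transpose := by
  simpa using H.transpose

lemma MinorsLE.of_equivalentMat (hA : MinorsLE c h e A) (H : EquivalentMat h e A h' e' A') :
    MinorsLE c h' e' A' := by
  obtain ⟨L, L', C, C', ⟨l1, l2, l3, l4⟩, ⟨c1, c2, c3, c4⟩, rfl⟩ := H
  simpa using (l1.mul hA).mul c1

lemma EquivalentMat.one_add_mul {T : Matrix ι ι K} (hT : MinorsLE 1 h h T) (hTT : T * T = 0) :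
    EquivalentMat h e A h e ((1 + T) * A) := by
  refine ⟨1 + T, 1 + -T, 1, 1, ⟨MinorsLE.one.add hT, MinorsLE.one.add hT.neg, ?_, ?_⟩,
    ⟨.one, .one, one_mul _, one_mul _⟩, by simp⟩ <;>
  simp [Matrix.add_mul, Matrix.mul_add, hTT]

/-- If all minor ideals of the column `j` are contained in the one at `(p, j)`, the column can be
cleared outside the row `p` without changing this row. -/
lemma exists_clear_column (p : ι) (j : κ) (hp : ∀ i, minorAt h e A i j ≤ minorAt h e A p j) :
    ∃ A' : Matrix ι κ K, EquivalentMat h e A h e A' ∧ (∀ k, A' p k = A p k) ∧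
      ∀ i, i ≠ p → A' i j = 0 := by
  by_cases ha : A p j = 0
  · refine ⟨A, .refl _ _ _, fun _ => rfl, fun i _ => ?_⟩
    have := hp i
    rw [minorAt_le_iff, minorAt, ha] at this
    have h0 : spanSingleton Z⁰ (A i j) * (e j : FractionalIdeal Z⁰ K) = 0 := by
      simpa using this
    rw [Units.mul_left_eq_zero] at h0
    rw [spanSingleton_eq_zero_iff.1 h0]
  set T : Matrix ι ι K := Matrix.of fun i k => if k = p ∧ i ≠ p then -(A i j / A p j) else 0
    with hTdef
  have hT : MinorsLE 1 h h T := by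
    intro i k
    by_cases hk : k = p ∧ i ≠ p
    · obtain ⟨rfl, hi⟩ := hk
      simp only [hTdef, Matrix.of_apply, hi, ne_eq, not_false_eq_true, and_self, if_true, one_mul]
      refine spanSingleton_neg_le ?_
      have := hp i
      rw [minorAt, minorAt, mul_inv_le_iff_le_mul] at this
      have h2 := mul_le_mul_right this (((e j)⁻¹ * h k : (FractionalIdeal Z⁰ K)ˣ) :
        FractionalIdeal Z⁰ K)
      have h3 : spanSingleton Z⁰ (A i j) * (h k : FractionalIdeal Z⁰ K) ≤
          spanSingleton Z⁰ (A k j) * (h i : FractionalIdeal Z⁰ K) := by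
        convert h2 using 1
        · rw [Units.val_mul]
          calc _ = spanSingleton Z⁰ (A i j) * (h k : FractionalIdeal Z⁰ K) *
              (((e j)⁻¹ : (FractionalIdeal Z⁰ K)ˣ) * e j) := by simp
            _ = _ := by ring
        · rw [Units.val_mul]
          calc _ = spanSingleton Z⁰ (A k j) * (h i : FractionalIdeal Z⁰ K) *
              ((((e j)⁻¹ : (FractionalIdeal Z⁰ K)ˣ) * e j) *
                (((h k)⁻¹ : (FractionalIdeal Z⁰ K)ˣ) * h k)) := by simp
            _ = _ := by ring
      have h4 := mul_le_mul_right h3 (spanSingleton Z⁰ (A k j)⁻¹)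
      rw [← mul_assoc, ← mul_assoc, spanSingleton_mul_spanSingleton,
        spanSingleton_mul_spanSingleton, inv_mul_cancel₀ ha, spanSingleton_one, one_mul,
        mul_comm _ (A i j), ← div_eq_mul_inv] at h4
      exact h4
    · simp [hTdef, hk]
  have hTA : ∀ i k, (T * A) i k = if i ≠ p then -(A i j / A p j) * A p k else 0 := by
    intro i k
    rw [Matrix.mul_apply, Finset.sum_eq_single p]
    · by_cases hi : i = p <;> simp [hTdef, hi]
    · intro b _ hb
      simp [hTdef, hb]
    · simp
  refine ⟨_, .one_add_mul hT ?_, fun k => ?_, fun i hi => ?_⟩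
  · ext i k
    rw [Matrix.mul_apply]
    refine Finset.sum_eq_zero fun x _ => ?_
    by_cases hx : x = p <;> simp [hTdef, hx]
  · simp [Matrix.add_mul, hTA]
  · simp [Matrix.add_mul, hTA, hi, ha]

/-- The endomorphism acting on the coordinates `p` and `q` by the matrix `(u, v; w, z)`. -/
def pairMap (p q : ι) (u v w z : K) : (ι → K) →ₗ[K] (ι → K) where
  toFun x := fun i => if i = p then u * x p + v * x q else if i = q then w * x p + z * x q else x i
  map_add' x y := by
    ext i
    simp only [Pi.add_apply]
    split_ifs <;> ring
  map_smul' t x := by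
    ext i
    simp only [Pi.smul_apply, smul_eq_mul, RingHom.id_apply]
    split_ifs <;> ring

lemma pairMap_apply {ι : Type*} [DecidableEq ι] (p q : ι) (u v w z : K) (x : ι → K) (i : ι) :
    pairMap p q u v w z x i =
      if i = p then u * x p + v * x q else if i = q then w * x p + z * x q else x i := rfl

lemma pairMap_comp {p q : ι} (hpq : p ≠ q) {u v w z u' v' w' z' : K}
    (h1 : u * u' + v * w' = 1) (h2 : u * v' + v * z' = 0)
    (h3 : w * u' + z * w' = 0) (h4 : w * v' + z * z' = 1) :
    LinearMap.toMatrix' (pairMap p q u v w z) * LinearMap.toMatrix' (pairMap p q u' v' w' z')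
      = 1 := by
  rw [← LinearMap.toMatrix'_comp, ← LinearMap.toMatrix'_id]
  congr 1
  refine LinearMap.ext fun x => funext fun i => ?_
  simp only [LinearMap.comp_apply, pairMap_apply, LinearMap.id_apply, if_true, hpq.symm, if_false]
  split_ifs with hp hq
  · subst hp; linear_combination x i * h1 + x q * h2
  · subst hq; linear_combination x p * h3 + x i * h4
  · rfl

lemma minorsLE_pairMap {p q : ι} (hpq : p ≠ q) {u v w z : K}
    (h1 : spanSingleton Z⁰ u * (h p : FractionalIdeal Z⁰ K) ≤ h' p)
    (h2 : spanSingleton Z⁰ v * (h q : FractionalIdeal Z⁰ K) ≤ h' p)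
    (h3 : spanSingleton Z⁰ w * (h p : FractionalIdeal Z⁰ K) ≤ h' q)
    (h4 : spanSingleton Z⁰ z * (h q : FractionalIdeal Z⁰ K) ≤ h' q)
    (h5 : ∀ i, i ≠ p → i ≠ q → h' i = h i) :
    MinorsLE 1 h' h (LinearMap.toMatrix' (pairMap p q u v w z)) := by
  intro i j
  rw [LinearMap.toMatrix'_apply, pairMap_apply, one_mul]
  by_cases hip : i = p
  · subst hip
    rw [if_pos rfl]
    by_cases hj : i = j
    · subst hj; simpa [hpq] using h1
    · by_cases hj' : q = j
      · subst hj'; simpa [hpq.symm, hpq] using h2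
      · simp [hj, hj']
  rw [if_neg hip]
  by_cases hiq : i = q
  · subst hiq
    rw [if_pos rfl]
    by_cases hj : i = j
    · subst hj; simpa [hpq.symm, hpq] using h4
    · by_cases hj' : p = j
      · subst hj'; simpa [hpq.symm, hpq] using h3
      · simp [hj, hj']
  rw [if_neg hiq]
  by_cases hj : i = j
  · subst hj; simp [h5 i hip hiq]
  · simp [hj]

end Minors

section Dedekind

variable {Z : Type*} [CommRing Z] {K : Type*} [Field K] [Algebra Z K] [IsFractionRing Z K]

/-- Nonzero ideals of a Noetherian Prüfer domain are invertible. -/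
lemma _root_.IsPruferDomain.isUnit_coeIdeal [IsNoetherianRing Z] (hZ : IsPruferDomain Z)
    {J : Ideal Z} (hJ : J ≠ ⊥) : IsUnit (J : FractionalIdeal Z⁰ K) := by
  have := hZ.isDomain
  obtain ⟨n, a, ha⟩ := Submodule.fg_iff_exists_fin_generating_family.1
    (IsNoetherian.noetherian J)
  rcases n with _ | n
  · exact absurd (by rw [← ha]; simp [Set.range_eq_empty]) hJ
  obtain ⟨s, hs, hsa⟩ := hZ.locallyPrincipal n a
  change Ideal.span (Set.range a) = J at ha
  rw [ha] at hsa
  have hJ0 : (J : FractionalIdeal Z⁰ K) ≠ 0 := coeIdeal_ne_zero.2 hJ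
  have hdvd : ∀ i, ∀ x ∈ J, ∃ z, s i * x = a i * z := fun i x hx =>
    Ideal.mem_span_singleton.1 (hsa i x hx)
  have hmem : ∀ i, algebraMap Z K (s i) / algebraMap Z K (a i) ∈
      (J : FractionalIdeal Z⁰ K)⁻¹ := by
    intro i
    rw [mem_inv_iff hJ0]
    intro y hy
    obtain ⟨x, hx, rfl⟩ := (mem_coeIdeal _).1 hy
    obtain ⟨z, hz⟩ := hdvd i x hx
    by_cases h0 : a i = 0
    · simp [h0]
    · have h0' : algebraMap Z K (a i) ≠ 0 := by
        simpa using h0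
      refine (mem_one_iff _).2 ⟨z, ?_⟩
      rw [div_mul_eq_mul_div, eq_div_iff h0', ← map_mul, ← map_mul, hz, mul_comm]
  obtain ⟨x, hxJ, hx0⟩ := Submodule.exists_mem_ne_zero_of_ne_bot hJ
  have hone : (1 : K) ∈ (J : FractionalIdeal Z⁰ K) * (J : FractionalIdeal Z⁰ K)⁻¹ := by
    have h1 : (1 : K) = ∑ i, algebraMap Z K (a i) *
        (algebraMap Z K (s i) / algebraMap Z K (a i)) := by
      rw [← map_one (algebraMap Z K), ← hs, map_sum]
      refine Finset.sum_congr rfl fun i _ => ?_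
      by_cases h0 : a i = 0
      · obtain ⟨z, hz⟩ := hdvd i x hxJ
        rw [h0, zero_mul] at hz
        simp [h0, (mul_eq_zero.1 hz).resolve_right hx0]
      · rw [mul_div_cancel₀]
        simpa using h0
    rw [h1]
    refine Submodule.sum_mem (((J : FractionalIdeal Z⁰ K) * (J : FractionalIdeal Z⁰ K)⁻¹ :
      FractionalIdeal Z⁰ K) : Submodule Z K) fun i _ => ?_
    exact mul_mem_mul (mem_coeIdeal_of_mem _ (ha ▸ Ideal.subset_span ⟨i, rfl⟩)) (hmem i)
  rw [← mul_inv_cancel_iff_isUnit]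
  refine le_antisymm ?_ (one_le.2 hone)
  rw [mul_le]
  intro i hi y hy
  rw [mul_comm]
  exact (mem_inv_iff hJ0).1 hy i hi

lemma _root_.IsPruferDomain.isUnit_fractionalIdeal [IsNoetherianRing Z] (hZ : IsPruferDomain Z)
    {I : FractionalIdeal Z⁰ K} (hI : I ≠ 0) : IsUnit I := by
  have := hZ.isDomain
  obtain ⟨a, J, ha, rfl⟩ := exists_eq_spanSingleton_mul I
  have ha' : (algebraMap Z K a)⁻¹ ≠ 0 := by simpa using ha
  refine IsUnit.mul ?_ (hZ.isUnit_coeIdeal fun hJ => hI (by simp [hJ]))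
  exact (mul_inv_cancel_iff_isUnit K).1 (spanSingleton_mul_inv K ha')

end Dedekind

section Smith

variable {Z : Type*} [CommRing Z] {K : Type*} [Field K] [Algebra Z K] [IsFractionRing Z K]
variable {ι κ : Type*} [Fintype ι] [DecidableEq ι] [Fintype κ] [DecidableEq κ]
  {h h' : ι → (FractionalIdeal Z⁰ K)ˣ} {e e' : κ → (FractionalIdeal Z⁰ K)ˣ}
  {A A' : Matrix ι κ K}

/-- An invertible row operation replaces the minor ideal at `(p, j)` by its sum with the one at
`(q, j)`. -/
lemma exists_row_gcd (hU : ∀ I : FractionalIdeal Z⁰ K, I ≠ 0 → IsUnit I)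
    {p q : ι} (hpq : p ≠ q) (j : κ) :
    ∃ (h' : ι → (FractionalIdeal Z⁰ K)ˣ) (A' : Matrix ι κ K), EquivalentMat h e A h' e A' ∧
      minorAt h' e A' p j = minorAt h e A p j + minorAt h e A q j := by
  by_cases hq0 : A q j = 0
  · exact ⟨h, A, .refl _ _ _, by simp [minorAt, hq0]⟩
  set a := A p j with ha
  set b := A q j with hb
  have hsb : spanSingleton Z⁰ b ≠ 0 := spanSingleton_ne_zero_iff.2 hq0
  have hc0 : minorAt h e A p j + minorAt h e A q j ≠ 0 := by
    rw [Ne, add_eq_zero, not_and_or]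
    right
    rw [minorAt, Units.mul_left_eq_zero, Units.mul_left_eq_zero]
    exact hsb
  obtain ⟨γ, hγ⟩ := hU _ hc0
  have hW0 : spanSingleton Z⁰ b * (h p : FractionalIdeal Z⁰ K) +
      spanSingleton Z⁰ a * (h q : FractionalIdeal Z⁰ K) ≠ 0 := by
    rw [Ne, add_eq_zero, not_and_or]
    left
    rw [Units.mul_left_eq_zero]
    exact hsb
  obtain ⟨W, hW⟩ := hU _ hW0
  have hle : ∀ i, minorAt h e A i j ≤ γ → spanSingleton Z⁰ (A i j) *
      ((e j * γ⁻¹ : (FractionalIdeal Z⁰ K)ˣ) : FractionalIdeal Z⁰ K) ≤ h i := by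
    intro i hi
    rw [Units.val_mul, ← mul_assoc, mul_inv_le_iff_le_mul, mul_comm (h i : FractionalIdeal Z⁰ K)]
    exact minorAt_le_iff.1 hi
  have hpH := hle p (hγ ▸ le_self_add)
  have hqH := hle q (hγ ▸ le_add_self)
  have hone : (1 : K) ∈
      spanSingleton Z⁰ a * ((e j * γ⁻¹ * (h p)⁻¹ : (FractionalIdeal Z⁰ K)ˣ) :
        FractionalIdeal Z⁰ K) +
      spanSingleton Z⁰ b * ((e j * γ⁻¹ * (h q)⁻¹ : (FractionalIdeal Z⁰ K)ˣ) :
        FractionalIdeal Z⁰ K) := by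
    have : (minorAt h e A p j + minorAt h e A q j) *
      ((γ⁻¹ : (FractionalIdeal Z⁰ K)ˣ) : FractionalIdeal Z⁰ K) = 1 := by
      rw [← hγ, Units.mul_inv]
    refine one_le.1 (this.symm.le.trans (le_of_eq ?_))
    simp only [minorAt, Units.val_mul]
    ring
  obtain ⟨x, hx, y, hy, hxy⟩ := (mem_add _ _ _).1 hone
  obtain ⟨u, hu, rfl⟩ := mem_singleton_mul.1 hx
  obtain ⟨v, hv, rfl⟩ := mem_singleton_mul.1 hy
  have hu' : spanSingleton Z⁰ u * (h p : FractionalIdeal Z⁰ K) ≤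
      ((e j * γ⁻¹ : (FractionalIdeal Z⁰ K)ˣ) : FractionalIdeal Z⁰ K) := by
    rw [← inv_inv (h p), mul_inv_le_iff_le_mul, ← Units.val_mul]
    exact spanSingleton_le_iff_mem.2 hu
  have hv' : spanSingleton Z⁰ v * (h q : FractionalIdeal Z⁰ K) ≤
      ((e j * γ⁻¹ : (FractionalIdeal Z⁰ K)ˣ) : FractionalIdeal Z⁰ K) := by
    rw [← inv_inv (h q), mul_inv_le_iff_le_mul, ← Units.val_mul]
    exact spanSingleton_le_iff_mem.2 hv
  have hsplit : ∀ {t : K} {i : ι},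
      spanSingleton Z⁰ (t * b) * (h p : FractionalIdeal Z⁰ K) ≤ h i →
      spanSingleton Z⁰ (t * a) * (h q : FractionalIdeal Z⁰ K) ≤ h i →
      spanSingleton Z⁰ t * (W : FractionalIdeal Z⁰ K) ≤ h i := by
    intro t i h1 h2
    rw [hW, mul_add, ← mul_assoc, ← mul_assoc, spanSingleton_mul_spanSingleton,
      spanSingleton_mul_spanSingleton, ← sup_eq_add]
    exact sup_le h1 h2
  set h' : ι → (FractionalIdeal Z⁰ K)ˣ :=
    fun i => if i = p then e j * γ⁻¹ else if i = q then W else h i with hh'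
  have h'p : h' p = e j * γ⁻¹ := by simp [hh']
  have h'q : h' q = W := by simp [hh', hpq.symm]
  have h'i : ∀ i, i ≠ p → i ≠ q → h' i = h i := fun i h1 h2 => by simp [hh', h1, h2]
  refine ⟨h', LinearMap.toMatrix' (pairMap p q u v (-b) a) * A,
    ⟨LinearMap.toMatrix' (pairMap p q u v (-b) a), LinearMap.toMatrix' (pairMap p q a (-v) b u),
      1, 1, ⟨?_, ?_, ?_, ?_⟩, ⟨.one, .one, one_mul _, one_mul _⟩, by simp⟩, ?_⟩
  · refine minorsLE_pairMap hpq (h'p ▸ hu') (h'p ▸ hv') ?_ ?_ h'i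
    · rw [h'q, hW]
      exact spanSingleton_neg_le le_self_add
    · rw [h'q, hW]
      exact le_add_self
  · refine minorsLE_pairMap hpq (h'p ▸ hpH) ?_ (h'p ▸ hqH) ?_ fun i h1 h2 => (h'i i h1 h2).symm
    · rw [h'q]
      refine spanSingleton_neg_le (hsplit ?_ ?_)
      · have h1 : v * b = 1 + -(a * u) := by linear_combination hxy
        rw [h1]
        refine spanSingleton_add_le (by simp) (spanSingleton_neg_le ?_)
        exact spanSingleton_mul_mul_le hu' hpH
      · rw [mul_comm v]
        exact spanSingleton_mul_mul_le hv' hpH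
    · rw [h'q]
      refine hsplit ?_ ?_
      · rw [mul_comm u]
        exact spanSingleton_mul_mul_le hu' hqH
      · have h1 : u * a = 1 + -(b * v) := by linear_combination hxy
        rw [h1]
        refine spanSingleton_add_le (by simp) (spanSingleton_neg_le ?_)
        exact spanSingleton_mul_mul_le hv' hqH
  · apply pairMap_comp hpq
    · linear_combination hxy
    · ring
    · ring
    · linear_combination hxy
  · apply pairMap_comp hpq
    · linear_combination hxy
    · ring
    · ring
    · linear_combination hxy
  · have hent : (LinearMap.toMatrix' (pairMap p q u v (-b) a) * A) p j = 1 := by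
      change (Matrix.mulVec (LinearMap.toMatrix' (pairMap p q u v (-b) a)) fun k => A k j) p = 1
      rw [LinearMap.toMatrix'_mulVec, pairMap_apply, if_pos rfl]
      linear_combination hxy
    rw [minorAt, hent, h'p, ← hγ, spanSingleton_one, one_mul, ← Units.val_mul]
    congr 1
    rw [mul_inv_rev, inv_inv, mul_comm γ, mul_inv_cancel_left]

lemma exists_column_gcd (hU : ∀ I : FractionalIdeal Z⁰ K, I ≠ 0 → IsUnit I)
    {p q : κ} (hpq : p ≠ q) (i : ι) :
    ∃ (e' : κ → (FractionalIdeal Z⁰ K)ˣ) (A' : Matrix ι κ K), EquivalentMat h e A h e' A' ∧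
      minorAt h e' A' i p = minorAt h e A i p + minorAt h e A i q := by
  obtain ⟨e', A', H, H'⟩ := exists_row_gcd (h := e⁻¹) (e := h⁻¹) (A := A.transpose) hU hpq i
  rw [← inv_inv e'] at H H'
  refine ⟨e'⁻¹, A'.transpose, H.of_transpose, ?_⟩
  rw [← minorAt_transpose, Matrix.transpose_transpose, H', minorAt_transpose, minorAt_transpose]

lemma exists_maximal_minorAt [IsNoetherianRing Z] (hA : MinorsLE 1 h e A) (p : ι) (q : κ) :
    ∃ (h' : ι → (FractionalIdeal Z⁰ K)ˣ) (e' : κ → (FractionalIdeal Z⁰ K)ˣ) (A' : Matrix ι κ K),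
      EquivalentMat h e A h' e' A' ∧ ∀ h'' e'' A'', EquivalentMat h' e' A' h'' e'' A'' →
        ¬ minorAt h' e' A' p q < minorAt h'' e'' A'' p q := by
  set S : Set (Ideal Z) := {I | ∃ h' e' A', EquivalentMat h e A h' e' A' ∧
    (I : FractionalIdeal Z⁰ K) = minorAt h' e' A' p q} with hS
  have hex : ∀ h' e' A', EquivalentMat h e A h' e' A' → ∃ I ∈ S,
      (I : FractionalIdeal Z⁰ K) = minorAt h' e' A' p q := by
    intro h' e' A' H
    obtain ⟨I, hI⟩ := le_one_iff_exists_coeIdeal.1 ((hA.of_equivalentMat H).minorAt_le p q)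
    exact ⟨I, ⟨h', e', A', H, hI⟩, hI⟩
  obtain ⟨I₀, hI₀, -⟩ := hex h e A (.refl _ _ _)
  obtain ⟨I, ⟨h', e', A', H, hI⟩, hmax⟩ :=
    set_has_maximal_iff_noetherian.2 (inferInstanceAs (IsNoetherian Z Z)) S ⟨I₀, hI₀⟩
  refine ⟨h', e', A', H, fun h'' e'' A'' H' hlt => ?_⟩
  obtain ⟨J, hJ, hJ'⟩ := hex h'' e'' A'' (H.trans H')
  rw [← hI, ← hJ', lt_iff_le_not_ge, coeIdeal_le_coeIdeal, coeIdeal_le_coeIdeal,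
    ← lt_iff_le_not_ge] at hlt
  exact hmax J hJ hlt

lemma exists_clear_row (p : ι) (q : κ) (hp : ∀ j, minorAt h e A p j ≤ minorAt h e A p q) :
    ∃ A' : Matrix ι κ K, EquivalentMat h e A h e A' ∧ (∀ i, A' i q = A i q) ∧
      ∀ j, j ≠ q → A' p j = 0 := by
  obtain ⟨A', H, h1, h2⟩ := exists_clear_column (h := e⁻¹) (e := h⁻¹) (A := A.transpose) q p
    (by simpa only [minorAt_transpose] using hp)
  exact ⟨A'.transpose, H.of_transpose, h1, h2⟩

/-- Every pseudo-matrix is equivalent to one whose row `p` and column `q` vanish outside `(p, q)`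
and in which the minor ideal at `(p, q)` contains all the others. -/
lemma exists_dominating_minorAt [IsNoetherianRing Z]
    (hU : ∀ I : FractionalIdeal Z⁰ K, I ≠ 0 → IsUnit I) (hA : MinorsLE 1 h e A)
    (p : ι) (q : κ) :
    ∃ (h' : ι → (FractionalIdeal Z⁰ K)ˣ) (e' : κ → (FractionalIdeal Z⁰ K)ˣ) (A' : Matrix ι κ K),
      EquivalentMat h e A h' e' A' ∧ (∀ i, i ≠ p → A' i q = 0) ∧ (∀ j, j ≠ q → A' p j = 0) ∧
        MinorsLE (minorAt h' e' A' p q) h' e' A' := by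
  obtain ⟨h', e', B, HB, hmax⟩ := exists_maximal_minorAt hA p q
  have hrow : ∀ {B' : Matrix ι κ K}, EquivalentMat h' e' B h' e' B' → B' p q = B p q →
      ∀ j, minorAt h' e' B' p j ≤ minorAt h' e' B p q := by
    intro B' H hpq j
    have hm : minorAt h' e' B' p q = minorAt h' e' B p q := by rw [minorAt, minorAt, hpq]
    by_cases hj : q = j
    · subst hj; exact hm.le
    obtain ⟨e'', B'', H', hB''⟩ := exists_column_gcd (h := h') (e := e') (A := B') hU hj p
    have := hmax _ _ _ (H.trans H')
    rw [hB'', hm] at this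
    have hle : minorAt h' e' B p q ≤ minorAt h' e' B p q + minorAt h' e' B' p j := le_self_add
    rw [eq_of_le_of_not_lt hle this]
    exact le_add_self
  have hcol : ∀ i, minorAt h' e' B i q ≤ minorAt h' e' B p q := by
    intro i
    by_cases hi : p = i
    · subst hi; exact le_rfl
    obtain ⟨h'', B'', H', hB''⟩ := exists_row_gcd (h := h') (e := e') (A := B) hU hi q
    have := hmax _ _ _ H'
    rw [hB''] at this
    have hle : minorAt h' e' B p q ≤ minorAt h' e' B p q + minorAt h' e' B i q := le_self_add
    rw [eq_of_le_of_not_lt hle this]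
    exact le_add_self
  obtain ⟨C, HC, hC1, hC2⟩ := exists_clear_column p q hcol
  have hCm : minorAt h' e' C p q = minorAt h' e' B p q := by rw [minorAt, minorAt, hC1]
  obtain ⟨D, HD, hD1, hD2⟩ := exists_clear_row (h := h') (e := e') (A := C) p q
    (by rw [hCm]; exact hrow HC (hC1 q))
  have hBD := HC.trans HD
  have hDpq : D p q = B p q := by rw [hD1, hC1]
  have hDm : minorAt h' e' D p q = minorAt h' e' B p q := by rw [minorAt, minorAt, hDpq]
  refine ⟨h', e', D, HB.trans hBD, fun i hi => by rw [hD1, hC2 i hi], hD2, fun i j => ?_⟩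
  rw [← minorAt_le_iff, hDm]
  by_cases hi : i = p
  · subst hi; exact hrow hBD hDpq j
  by_cases hj : j = q
  · subst hj
    simp [minorAt, hD1, hC2 i hi]
  have hkey : ((h' p * (h' i)⁻¹ : (FractionalIdeal Z⁰ K)ˣ) : FractionalIdeal Z⁰ K) *
      (spanSingleton Z⁰ (D i j) * (e' j : FractionalIdeal Z⁰ K) *
        (((h' p)⁻¹ : (FractionalIdeal Z⁰ K)ˣ) : FractionalIdeal Z⁰ K)) ≤ minorAt h' e' B p q := by
    rw [mul_le]
    intro t ht x hx
    set T : Matrix ι ι K := Matrix.single p i t with hT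
    have hTle : MinorsLE 1 h' h' T := by
      intro k l
      by_cases hkl : p = k ∧ i = l
      · obtain ⟨rfl, rfl⟩ := hkl
        rw [hT, Matrix.single_apply_same, one_mul, ← inv_inv (h' i), mul_inv_le_iff_le_mul,
          ← Units.val_mul]
        exact spanSingleton_le_iff_mem.2 ht
      · rw [hT, Matrix.single_apply, if_neg hkl]
        exact spanSingleton_zero_mul_le _ _
    have hTT : T * T = 0 := Matrix.single_mul_single_of_ne _ _ _ _ hi _
    have hTD : ∀ k, ((1 + T) * D : Matrix ι κ K) p k = D p k + t * D i k := by
      intro k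
      simp [Matrix.add_mul, hT]
    have := hrow (hBD.trans (.one_add_mul hTle hTT)) (by
      rw [hTD, hD1 i, hC2 i hi, mul_zero, add_zero, hDpq]) j
    rw [minorAt, hTD, hD2 j hj, zero_add, ← spanSingleton_mul_spanSingleton, mul_assoc, mul_assoc,
      ← mul_assoc _ _ (((h' p)⁻¹ : (FractionalIdeal Z⁰ K)ˣ) : FractionalIdeal Z⁰ K)] at this
    exact this (mul_mem_mul (mem_spanSingleton_self _ t) hx)
  refine le_of_eq_of_le ?_ hkey
  rw [minorAt, Units.val_mul]
  calc _ = spanSingleton Z⁰ (D i j) * (e' j : FractionalIdeal Z⁰ K) *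
        (((h' i)⁻¹ : (FractionalIdeal Z⁰ K)ˣ) : FractionalIdeal Z⁰ K) *
        (h' p * ((h' p)⁻¹ : (FractionalIdeal Z⁰ K)ˣ)) := by simp
    _ = _ := by ring

end Smith

section Induction

variable {Z : Type*} [CommRing Z] {K : Type*} [Field K] [Algebra Z K] [IsFractionRing Z K]

/-- The block diagonal matrix with blocks `(a)` and `M`. -/
def consDiag {R : Type*} [Zero R] {n m : ℕ} (a : R) (M : Matrix (Fin n) (Fin m) R) :
    Matrix (Fin (n + 1)) (Fin (m + 1)) R :=
  Matrix.of (Fin.cons (Fin.cons a 0) fun i => Fin.cons 0 (M i))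

section consDiag

variable {R : Type*} {n m l : ℕ}

@[simp] lemma consDiag_zero_zero [Zero R] (a : R) (M : Matrix (Fin n) (Fin m) R) :
    consDiag a M 0 0 = a := rfl

@[simp] lemma consDiag_zero_succ [Zero R] (a : R) (M : Matrix (Fin n) (Fin m) R) (j : Fin m) :
    consDiag a M 0 j.succ = 0 := rfl

@[simp] lemma consDiag_succ_zero [Zero R] (a : R) (M : Matrix (Fin n) (Fin m) R) (i : Fin n) :
    consDiag a M i.succ 0 = 0 := rfl

@[simp] lemma consDiag_succ_succ [Zero R] (a : R) (M : Matrix (Fin n) (Fin m) R) (i : Fin n)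
    (j : Fin m) : consDiag a M i.succ j.succ = M i j := rfl

lemma consDiag_mul [Semiring R] (a b : R) (M : Matrix (Fin n) (Fin m) R)
    (N : Matrix (Fin m) (Fin l) R) : consDiag a M * consDiag b N = consDiag (a * b) (M * N) := by
  ext i j
  rw [Matrix.mul_apply, Fin.sum_univ_succ]
  refine Fin.cases ?_ (fun i => ?_) i <;> refine Fin.cases ?_ (fun j => ?_) j <;>
    simp [Matrix.mul_apply]

lemma consDiag_one [Semiring R] : consDiag 1 (1 : Matrix (Fin n) (Fin n) R) = 1 := by
  ext i j
  refine Fin.cases ?_ (fun i => ?_) i <;> refine Fin.cases ?_ (fun j => ?_) j <;>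
    simp [Matrix.one_apply, Fin.succ_ne_zero, (Fin.succ_ne_zero _).symm]

lemma eq_consDiag [Zero R] {M : Matrix (Fin (n + 1)) (Fin (m + 1)) R}
    (hc : ∀ i, i ≠ 0 → M i 0 = 0) (hr : ∀ j, j ≠ 0 → M 0 j = 0) :
    M = consDiag (M 0 0) (M.submatrix Fin.succ Fin.succ) := by
  ext i j
  refine Fin.cases ?_ (fun i => ?_) i <;> refine Fin.cases ?_ (fun j => ?_) j
  · rfl
  · exact hr _ (Fin.succ_ne_zero _)
  · exact hc _ (Fin.succ_ne_zero _)
  · rfl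

end consDiag

lemma minorsLE_consDiag_one {n : ℕ} (u : (FractionalIdeal Z⁰ K)ˣ)
    {h e : Fin n → (FractionalIdeal Z⁰ K)ˣ} {M : Matrix (Fin n) (Fin n) K}
    (hM : MinorsLE 1 h e M) :
    MinorsLE 1 (Fin.cons u h : Fin (n + 1) → (FractionalIdeal Z⁰ K)ˣ) (Fin.cons u e)
      (consDiag 1 M) := by
  intro i j
  refine Fin.cases ?_ (fun i => ?_) i <;> refine Fin.cases ?_ (fun j => ?_) j
  · simp
  · simp
  · simp
  · simpa using hM i j

lemma EquivalentMat.consDiag {n m : ℕ} {h h' : Fin n → (FractionalIdeal Z⁰ K)ˣ}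
    {e e' : Fin m → (FractionalIdeal Z⁰ K)ˣ} {A A' : Matrix (Fin n) (Fin m) K}
    (H : EquivalentMat h e A h' e' A') (u v : (FractionalIdeal Z⁰ K)ˣ) (a : K) :
    EquivalentMat (Fin.cons u h : Fin (n + 1) → (FractionalIdeal Z⁰ K)ˣ)
      (Fin.cons v e : Fin (m + 1) → (FractionalIdeal Z⁰ K)ˣ) (consDiag a A)
      (Fin.cons u h') (Fin.cons v e') (consDiag a A') := by
  obtain ⟨L, L', C, C', ⟨l1, l2, l3, l4⟩, ⟨c1, c2, c3, c4⟩, rfl⟩ := H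
  refine ⟨PseudoMatrix.consDiag 1 L, PseudoMatrix.consDiag 1 L', PseudoMatrix.consDiag 1 C,
    PseudoMatrix.consDiag 1 C', ⟨minorsLE_consDiag_one u l1, minorsLE_consDiag_one u l2, ?_, ?_⟩,
    ⟨minorsLE_consDiag_one v c1, minorsLE_consDiag_one v c2, ?_, ?_⟩, ?_⟩ <;>
  simp [consDiag_mul, consDiag_one, *]

/-- Every pseudo-matrix is equivalent to a pseudo-matrix in Smith form. -/
theorem exists_equivalentMat_smith [IsNoetherianRing Z]
    (hU : ∀ I : FractionalIdeal Z⁰ K, I ≠ 0 → IsUnit I) {n m : ℕ}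
    (h : Fin n → (FractionalIdeal Z⁰ K)ˣ) (e : Fin m → (FractionalIdeal Z⁰ K)ˣ)
    (A : Matrix (Fin n) (Fin m) K) (hA : MinorsLE 1 h e A) :
    ∃ (h' : Fin n → (FractionalIdeal Z⁰ K)ˣ) (e' : Fin m → (FractionalIdeal Z⁰ K)ˣ)
      (A' : Matrix (Fin n) (Fin m) K), EquivalentMat h e A h' e' A' ∧
        (∀ (i : Fin n) (j : Fin m), (i : ℕ) ≠ (j : ℕ) → A' i j = 0) ∧
        ∀ (i k : Fin n) (j l : Fin m), (i : ℕ) = (j : ℕ) → (k : ℕ) = (l : ℕ) → i ≤ k →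
          minorAt h' e' A' k l ≤ minorAt h' e' A' i j := by
  induction n generalizing m with
  | zero => exact ⟨h, e, A, .refl _ _ _, fun i => i.elim0, fun i => i.elim0⟩
  | succ n ih =>
    rcases m with _ | m
    · exact ⟨h, e, A, .refl _ _ _, fun _ j => j.elim0, fun _ _ j => j.elim0⟩
    obtain ⟨h₁, e₁, B, HB, hc, hr, hB⟩ := exists_dominating_minorAt hU hA 0 0
    have hBdiag := eq_consDiag hc hr
    obtain ⟨h₂, e₂, D, HD, hD0, hD⟩ := ih (h₁ ∘ Fin.succ) (e₁ ∘ Fin.succ)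
      (B.submatrix Fin.succ Fin.succ) fun i j =>
        (hA.of_equivalentMat HB) i.succ j.succ
    have hDle : MinorsLE (minorAt h₁ e₁ B 0 0) h₂ e₂ D :=
      MinorsLE.of_equivalentMat (fun i j => hB i.succ j.succ) HD
    have HD' := HD.consDiag (h₁ 0) (e₁ 0) (B 0 0)
    rw [← hBdiag] at HD'
    have hh : (Fin.cons (h₁ 0) (h₁ ∘ Fin.succ) : Fin (n + 1) → (FractionalIdeal Z⁰ K)ˣ) = h₁ :=
      Fin.cons_self_tail h₁
    have he : (Fin.cons (e₁ 0) (e₁ ∘ Fin.succ) : Fin (m + 1) → (FractionalIdeal Z⁰ K)ˣ) = e₁ :=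
      Fin.cons_self_tail e₁
    rw [hh, he] at HD'
    refine ⟨_, _, _, HB.trans HD', fun i j hij => ?_, fun i k j l hij hkl hik => ?_⟩
    · induction i using Fin.cases <;> induction j using Fin.cases
      · simp at hij
      · rfl
      · rfl
      · exact hD0 _ _ (by simpa using hij)
    · induction k using Fin.cases with
      | zero =>
        obtain rfl : i = 0 := Fin.le_zero_iff.1 hik
        obtain rfl : j = l := Fin.ext (hij.symm.trans hkl)
        exact le_rfl
      | succ k =>
        induction l using Fin.cases with
        | zero => simp at hkl
        | succ l =>
          induction i using Fin.cases with
          | zero =>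
            obtain rfl : j = 0 := Fin.ext (by simpa using hij.symm)
            exact hDle.minorAt_le k l
          | succ i =>
            induction j using Fin.cases with
            | zero => simp at hij
            | succ j =>
              exact hD i k j l (by simpa using hij) (by simpa using hkl) (by simpa using hik)

end Induction

end PseudoMatrix

theorem mainTheorem8 {Z : Type*} [CommRing Z] [IsNoetherianRing Z]
    (hZ : IsPruferDomain Z) {K : Type*} [Field K] [Algebra Z K] [IsFractionRing Z K]
    {n m : ℕ} (h : Fin n → (FractionalIdeal Z⁰ K)ˣ) (e : Fin m → (FractionalIdeal Z⁰ K)ˣ)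
    (A : PseudoMatrix h e) :
    ∃ (h' : Fin n → (FractionalIdeal Z⁰ K)ˣ) (e' : Fin m → (FractionalIdeal Z⁰ K)ˣ)
      (A' : PseudoMatrix h' e'), A.Equivalent A' ∧ A'.IsSmith := by
  have hA := PseudoMatrix.minorsLE_iff_mem.2 A.mul_mem
  obtain ⟨h', e', A', H, hdiag, hanti⟩ := PseudoMatrix.exists_equivalentMat_smith
    (fun _ => hZ.isUnit_fractionalIdeal) h e A.mat hA
  have hA' := PseudoMatrix.minorsLE_iff_mem.1 (hA.of_equivalentMat H)
  obtain ⟨L, L', C, C', ⟨l1, l2, l3, l4⟩, ⟨c1, c2, c3, c4⟩, rfl⟩ := H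
  rw [PseudoMatrix.minorsLE_iff_mem] at l1 l2 c1 c2
  exact ⟨h', e', ⟨_, hA'⟩,
    ⟨⟨L, l1⟩, ⟨C, c1⟩, ⟨⟨L', l2⟩, PseudoMatrix.ext l3, PseudoMatrix.ext l4⟩,
      ⟨⟨C', c2⟩, PseudoMatrix.ext c3, PseudoMatrix.ext c4⟩, rfl⟩,
    hdiag, fun k l hkl => hanti _ _ _ _ rfl rfl hkl⟩
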